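/- Let $n\ge 1$ and let $e_{ij}$ be the matrix units of size $n$. For a field $K$ of characteristic zero let $\mathfrak h\subset \mathfrak{sl}(n,K)$ be the subalgebra of diagonal matrices, write $x\wedge y=x\otimes y-y\otimes x$, and let $SL(n,K)$ act on $\mathfrak{sl}(n)\wedge\mathfrak{sl}(n)$ by simultaneous conjugation. An element $r\in \mathfrak{sl}(n)\wedge\mathfrak{sl}(n)$ is a solution of the modified classical Yang–Baxter equation (MCYBE) if its Schouten bracket $[r,r]$ (up to a nonzero factor, $[r_{12},r_{13}]+[r_{12},r_{23}]+[r_{13},r_{23}]$) is nonzero and $\mathfrak{sl}(n)$-invariant. An *admissible triple* $\mathcal T=(S_1,S_2,T)$ consists of subsets $S_1,S_2\subseteq\{1,\dots,n-1\}$ and a bijection $T:S_1\to S_2$ such that (1) for every $i\in S_1$ there is an $r$ with $T^r(i)\notin S_1$, and (2) if $i,j\in S_1$ and $|i-j|=1$, then $|T(i)-T(j)|=1$. Write $\mathcal T\prec\mathcal T'$ if $S_1\subseteq S_1'$ and $T=T'|_{S_1}$. Put $\gamma=\sum_{i<j}e_{ij}\wedge e_{ji}$ and $$\alpha(\mathcal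 T)=2\sum_{a<b}\ \sum_{k\ge 1} T^k(e_{ab})\wedge e_{ba},$$ where the inner sum is over those $k$ for which $T^k(i)$ is defined for all $a\le i<b$, and then $T^k(e_{ab})=[e_{c_a,c_a+1},[e_{c_{a+1},c_{a+1}+1},[\dots,e_{c_{b-1},c_{b-1}+1}]]]$ with $c_i=T^k(i)$. Let $\mathcal T\prec\mathcal T'$ be admissible triples. (a) For every field $K$ of characteristic zero and every $\beta\in\mathfrak h\wedge\mathfrak h$ such that $r'=\gamma+\beta+\alpha(\mathcal T')$ is a solution of the MCYBE, $r=\gamma+\beta+\alpha(\mathcal T)$ lies in the Zariski closure of the $SL(n,K)$-orbit of $r'$. (b) If $K=\mathbb R$ or $\mathbb C$, then for every such $\beta$, $r$ lies in the closure of the $SL(n,K)$-orbit of $r'$ in the usual topology. Moreover there is an $h\in\mathfrak h$, not depending on $\beta$, such that, for every such $\beta$, $\exp(sh)\cdot r'\to r$ as $s\to+\infty$ ($s$ real). -/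

import Mathlib

open scoped TensorProduct Topology

namespace BelavinDrinfeld

/-- An admissible triple for `sl(ℓ + 1)`: a bijection `T : S₁ → S₂` between subsets of the set of
simple roots, which is identified with `Fin ℓ`, such that every `i ∈ S₁` eventually leaves `S₁`
under iteration of `T`, and `T` preserves adjacency. (The values of `T` off `S₁` play no role.) -/
structure AdmissibleTriple (ℓ : ℕ) where
  S₁ : Finset (Fin ℓ)
  S₂ : Finset (Fin ℓ)
  T : Fin ℓ → Fin ℓ
  bijOn : Set.BijOn T S₁ S₂
  leaves : ∀ i ∈ S₁, ∃ r : ℕ, T^[r] i ∉ S₁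
  adjacent : ∀ i ∈ S₁, ∀ j ∈ S₁, |(i : ℤ) - (j : ℤ)| = 1 → |(T i : ℤ) - (T j : ℤ)| = 1

/-- `t ≺ t'`: the map of `t` is the restriction of the map of `t'` to a subset of its domain. -/
def AdmissibleTriple.Prec {ℓ : ℕ} (t t' : AdmissibleTriple ℓ) : Prop :=
  t.S₁ ⊆ t'.S₁ ∧ ∀ i ∈ t.S₁, t.T i = t'.T i

/-- `n × n` matrices. -/
abbrev Mat (n : ℕ) (K : Type*) := Matrix (Fin n) (Fin n) K

section Algebra

variable {n ℓ : ℕ} {K : Type*} [Field K]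

/-- `sl(n)`, the traceless matrices, as a subspace of all matrices. -/
def slSub (n : ℕ) (K : Type*) [Field K] : Submodule K (Mat n K) :=
  LinearMap.ker (Matrix.traceLinearMap (Fin n) K K)

/-- The Cartan subalgebra `𝔥` of `sl(n)`: the traceless diagonal matrices. -/
def cartan (n : ℕ) (K : Type*) [Field K] : Submodule K (Mat n K) where
  carrier := {x | x ∈ slSub n K ∧ x.IsDiag}
  add_mem' hx hy := ⟨add_mem hx.1 hy.1, hx.2.add hy.2⟩
  zero_mem' := ⟨zero_mem _, Matrix.isDiag_zero⟩
  smul_mem' c _ hx := ⟨Submodule.smul_mem _ c hx.1, hx.2.smul c⟩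

/-- `x ∧ y = x ⊗ y - y ⊗ x`. -/
def wedge (x y : Mat n K) : Mat n K ⊗[K] Mat n K := x ⊗ₜ[K] y - y ⊗ₜ[K] x

/-- `L ∧ L`, as a space of skew tensors. -/
def wedgeSq (L : Submodule K (Mat n K)) : Submodule K (Mat n K ⊗[K] Mat n K) :=
  Submodule.span K {w | ∃ x ∈ L, ∃ y ∈ L, w = wedge x y}

/-- `x ⊗ y ↦ x ⊗ y ⊗ 1`. -/
def leg12 : Mat n K ⊗[K] Mat n K →ₗ[K] Mat n K ⊗[K] (Mat n K ⊗[K] Mat n K) :=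
  LinearMap.lTensor (Mat n K) ((TensorProduct.mk K (Mat n K) (Mat n K)).flip 1)

/-- `x ⊗ y ↦ x ⊗ 1 ⊗ y`. -/
def leg13 : Mat n K ⊗[K] Mat n K →ₗ[K] Mat n K ⊗[K] (Mat n K ⊗[K] Mat n K) :=
  LinearMap.lTensor (Mat n K) (TensorProduct.mk K (Mat n K) (Mat n K) 1)

/-- `x ⊗ y ↦ 1 ⊗ x ⊗ y`. -/
def leg23 : Mat n K ⊗[K] Mat n K →ₗ[K] Mat n K ⊗[K] (Mat n K ⊗[K] Mat n K) :=
  TensorProduct.mk K (Mat n K) (Mat n K ⊗[K] Mat n K) 1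

/-- `[r₁₂, r₁₃] + [r₁₂, r₂₃] + [r₁₃, r₂₃]`, which for a skew tensor `r` is the Schouten bracket
`[r, r]` up to a nonzero normalization factor. -/
def schouten (r : Mat n K ⊗[K] Mat n K) : Mat n K ⊗[K] (Mat n K ⊗[K] Mat n K) :=
  ⁅leg12 r, leg13 r⁆ + ⁅leg12 r, leg23 r⁆ + ⁅leg13 r, leg23 r⁆

/-- `x ⊗ 1 ⊗ 1 + 1 ⊗ x ⊗ 1 + 1 ⊗ 1 ⊗ x`; the adjoint action of `x` on threefold tensors is the
commutator with this element. -/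
def diag3 (x : Mat n K) : Mat n K ⊗[K] (Mat n K ⊗[K] Mat n K) :=
  x ⊗ₜ[K] ((1 : Mat n K) ⊗ₜ[K] (1 : Mat n K)) + (1 : Mat n K) ⊗ₜ[K] (x ⊗ₜ[K] (1 : Mat n K))
    + (1 : Mat n K) ⊗ₜ[K] ((1 : Mat n K) ⊗ₜ[K] x)

/-- `r ∈ sl(n) ∧ sl(n)` solves the modified classical Yang-Baxter equation: `[r, r]` is nonzero
and `sl(n)`-invariant. -/
def IsMCYBESolution (r : Mat n K ⊗[K] Mat n K) : Prop :=
  r ∈ wedgeSq (slSub n K) ∧ schouten r ≠ 0 ∧ ∀ x ∈ slSub n K, ⁅diag3 x, schouten r⁆ = 0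

/-- The action `x ⊗ y ↦ g x g⁻¹ ⊗ g y g⁻¹` of an invertible matrix `g` on twofold tensors. -/
noncomputable def conj2 (g : Mat n K) : Mat n K ⊗[K] Mat n K →ₗ[K] Mat n K ⊗[K] Mat n K :=
  let c : Mat n K →ₗ[K] Mat n K := LinearMap.mulRight K g⁻¹ ∘ₗ LinearMap.mulLeft K g
  TensorProduct.map c c

/-- The `SL(n)`-orbit of `r`. -/
def orbit (r : Mat n K ⊗[K] Mat n K) : Set (Mat n K ⊗[K] Mat n K) :=
  Set.range fun g : Matrix.SpecialLinearGroup (Fin n) K => conj2 (g : Mat n K) r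

/-- `γ = ∑_{i < j} e_{ij} ∧ e_{ji}`. -/
def gamma (n : ℕ) (K : Type*) [Field K] : Mat n K ⊗[K] Mat n K :=
  ∑ p : Fin n × Fin n with p.1 < p.2,
    wedge (Matrix.single p.1 p.2 (1 : K)) (Matrix.single p.2 p.1 (1 : K))

/-- The simple root vector `e_{i,i+1}`. -/
def simpleVec (K : Type*) [Field K] (i : Fin ℓ) : Mat (ℓ + 1) K :=
  Matrix.single i.castSucc i.succ 1

/-- The simple roots, in increasing order, whose sum is the positive root of `e_{ab}`, `a < b`. -/
def simples (a b : Fin (ℓ + 1)) : List (Fin ℓ) :=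
  (List.finRange ℓ).filter fun i => a ≤ i.castSucc ∧ i.castSucc < b

/-- `[x₁, [x₂, …, [x_{m-1}, x_m]]]`. -/
def nestedBracket : List (Mat n K) → Mat n K
  | [] => 0
  | [x] => x
  | x :: y :: l => ⁅x, nestedBracket (y :: l)⁆

/-- The image of `e_{ab}`, `a < b`, under the `k`-th power of the Lie algebra map
`e_{i,i+1} ↦ e_{T(i),T(i)+1}`. For `k = 0` the result is `e_{ab}` itself. -/
def rootImage (K : Type*) [Field K] (t : AdmissibleTriple ℓ) (k : ℕ) (a b : Fin (ℓ + 1)) :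
    Mat (ℓ + 1) K :=
  nestedBracket ((simples a b).map fun i => simpleVec K (t.T^[k] i))

/-- `T^k` is defined on all simple roots that occur in the positive root of `e_{ab}`. -/
def PowDefined (t : AdmissibleTriple ℓ) (k : ℕ) (a b : Fin (ℓ + 1)) : Prop :=
  ∀ i ∈ simples a b, ∀ m < k, t.T^[m] i ∈ t.S₁

open Classical in
/-- `α(T) = 2 ∑ T^k(e_ρ) ∧ e_{-ρ}`, the sum over all positive roots `ρ` and all `k ≥ 1` such that
`T^k` is defined on `ρ`; this forces `k < ℓ`. -/
noncomputable def alpha (K : Type*) [Field K] (t : AdmissibleTriple ℓ) :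
    Mat (ℓ + 1) K ⊗[K] Mat (ℓ + 1) K :=
  (2 : K) • ∑ k ∈ Finset.Icc 1 ℓ,
    ∑ p : Fin (ℓ + 1) × Fin (ℓ + 1) with p.1 < p.2 ∧ PowDefined t k p.1 p.2,
      wedge (rootImage K t k p.1 p.2) (Matrix.single p.2 p.1 (1 : K))

/-- `γ + β + α(T)`. -/
noncomputable def bdTensor (β : Mat (ℓ + 1) K ⊗[K] Mat (ℓ + 1) K) (t : AdmissibleTriple ℓ) :
    Mat (ℓ + 1) K ⊗[K] Mat (ℓ + 1) K :=
  gamma (ℓ + 1) K + β + alpha K t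

/-- The polynomial functions on a vector space: the algebra of functions generated by the linear
functionals. -/
def polyFun (K V : Type*) [Field K] [AddCommGroup V] [Module K V] : Subalgebra K (V → K) :=
  Algebra.adjoin K {f | ∃ φ : Module.Dual K V, f = fun v => φ v}

/-- The Zariski closure of a subset of a vector space. -/
def zariskiClosure (K : Type*) {V : Type*} [Field K] [AddCommGroup V] [Module K V] (S : Set V) :
    Set V :=
  {v | ∀ f ∈ polyFun K V, (∀ s ∈ S, f s = 0) → f v = 0}

end Algebra

end BelavinDrinfeld

/-!
Both parts are witnessed by a single one-parameter subgroup of the diagonal torus of `SL(ℓ + 1)`.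

For a simple root `i` let `exitCount t t' i` be the number of members of the `T'`-string
`i, T' i, T'² i, …` in `S₁'` that do not belong to `S₁`. The string is finite by admissibility, and
for `i ∈ S₁'` one application of `T'` lowers the count by one if `i ∉ S₁` and leaves it unchanged if
`i ∈ S₁`. Hence `exitCount (T'^k i) ≤ exitCount i` whenever `T'^k` is defined at `i`, with equality
exactly when already `T^k` is defined at `i` (`exitCount_iterate_eq_iff`).

Choose integers `d_a` (`coweight`) of sum zero such that `d_i - d_{i+1}` is `ℓ + 1` times the count
of `i`; the factor `ℓ + 1` makes the normalization to sum zero integral. Conjugation by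
`diag(u^{d_a})` fixes `γ` and `β`, and multiplies `T'^k(e_{ab}) ∧ e_{ba}` by `u^{-m}`, where `m ≥ 0`
is `ℓ + 1` times the drop of the total count on the root of `e_{ab}`. Moreover `m = 0` exactly for
the terms of `α(T)`. In terms of `v = u⁻¹` the orbit of `r'` therefore contains `F(v)` for `v ≠ 0`,
where `F` is a polynomial curve (`degeneration`) with `F(0) = r`. A polynomial function that
vanishes on the orbit vanishes along `F` at all `v ≠ 0`, hence at `0`, as `K` is infinite; and over
`ℝ` or `ℂ` the substitution `u = exp s` gives `F(exp(-s)) → F(0)`.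
-/

namespace BelavinDrinfeld

variable {ℓ : ℕ} {K : Type*} [Field K]

/-! ### Counting exits from the smaller triple along strings of the larger one -/

/-- The steps `m` at which the `T'`-string starting at `i`, while still in `S₁'`, meets a root
outside `S₁`. -/
def exitSteps (t t' : AdmissibleTriple ℓ) (i : Fin ℓ) : Set ℕ :=
  {m | (∀ j ≤ m, t'.T^[j] i ∈ t'.S₁) ∧ t'.T^[m] i ∉ t.S₁}

/-- The number of roots in `S₁' \ S₁` on the `T'`-string starting at `i`. -/
noncomputable def exitCount (t t' : AdmissibleTriple ℓ) (i : Fin ℓ) : ℕ :=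
  (exitSteps t t' i).ncard

lemma exitSteps_finite (t t' : AdmissibleTriple ℓ) (i : Fin ℓ) : (exitSteps t t' i).Finite := by
  by_cases hi : i ∈ t'.S₁
  · obtain ⟨r, hr⟩ := t'.leaves i hi
    refine (Set.finite_lt_nat r).subset fun m hm => ?_
    by_contra hmr
    exact hr (hm.1 r (not_lt.1 hmr))
  · refine Set.finite_empty.subset fun m hm => hi ?_
    simpa using hm.1 0 (Nat.zero_le m)

lemma succ_mem_exitSteps_iff {t t' : AdmissibleTriple ℓ} {i : Fin ℓ} (hi : i ∈ t'.S₁) (m : ℕ) :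
    m + 1 ∈ exitSteps t t' i ↔ m ∈ exitSteps t t' (t'.T i) := by
  simp only [exitSteps, Set.mem_ofPred_eq, Function.iterate_succ_apply]
  refine and_congr_left fun _ => ⟨fun h j hj => ?_, fun h j hj => ?_⟩
  · simpa using h (j + 1) (by lia)
  · cases j with
    | zero => simpa using hi
    | succ j => simpa using h j (by lia)

open Classical in
lemma exitCount_eq {t t' : AdmissibleTriple ℓ} {i : Fin ℓ} (hi : i ∈ t'.S₁) :
    exitCount t t' i = exitCount t t' (t'.T i) + if i ∈ t.S₁ then 0 else 1 := by
  have himg : (Nat.succ '' exitSteps t t' (t'.T i)).ncard = exitCount t t' (t'.T i) :=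
    Set.ncard_image_of_injective _ Nat.succ_injective
  split_ifs with h
  · rw [← himg, exitCount, add_zero]
    congr 1
    ext (_ | m)
    · simp [exitSteps, h]
    · simp [succ_mem_exitSteps_iff hi]
  · rw [← himg, exitCount, ← Set.ncard_insert_of_notMem (a := 0) (by simp)
      ((exitSteps_finite t t' _).image _)]
    congr 1
    ext (_ | m)
    · simp [exitSteps, h, hi]
    · simp [succ_mem_exitSteps_iff hi]

lemma exitCount_iterate_le {t t' : AdmissibleTriple ℓ} {i : Fin ℓ} (k : ℕ)
    (h : ∀ m < k, t'.T^[m] i ∈ t'.S₁) : exitCount t t' (t'.T^[k] i) ≤ exitCount t t' i := by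
  induction k with
  | zero => simp
  | succ k ih =>
    have h1 := exitCount_eq (t := t) (h k (by lia))
    rw [← Function.iterate_succ_apply' t'.T] at h1
    exact le_trans (by lia) (ih fun m hm => h m (by lia))

lemma exitCount_iterate_eq_iff {t t' : AdmissibleTriple ℓ} {i : Fin ℓ} (k : ℕ)
    (h : ∀ m < k, t'.T^[m] i ∈ t'.S₁) :
    exitCount t t' (t'.T^[k] i) = exitCount t t' i ↔ ∀ m < k, t'.T^[m] i ∈ t.S₁ := by
  induction k with
  | zero => simp
  | succ k ih =>
    have h1 := exitCount_eq (t := t) (h k (by lia))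
    rw [← Function.iterate_succ_apply' t'.T] at h1
    have h2 := exitCount_iterate_le (t := t) k fun m hm => h m (by lia)
    rw [Nat.forall_lt_succ_right, ← ih fun m hm => h m (by lia)]
    split_ifs at h1 with h3
    · simp only [h3, and_true]; lia
    · simp only [h3, and_false, iff_false]; lia

/-! ### Comparison of the terms of the two tensors -/

lemma AdmissibleTriple.Prec.iterate_eq {t t' : AdmissibleTriple ℓ} (h : t.Prec t') {i : Fin ℓ}
    (k : ℕ) (hk : (∀ m < k, t.T^[m] i ∈ t.S₁) ∨ ∀ m < k, t'.T^[m] i ∈ t.S₁) :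
    t.T^[k] i = t'.T^[k] i := by
  induction k with
  | zero => rfl
  | succ k ih =>
    have h1 := ih (hk.imp (fun h m hm => h m (by lia)) (fun h m hm => h m (by lia)))
    rw [Function.iterate_succ_apply', Function.iterate_succ_apply', ← h1]
    refine h.2 _ ?_
    rcases hk with hk | hk
    · exact hk k (by lia)
    · exact h1 ▸ hk k (by lia)

lemma AdmissibleTriple.Prec.powDefined_iff {t t' : AdmissibleTriple ℓ} (h : t.Prec t') (k : ℕ)
    (a b : Fin (ℓ + 1)) :
    PowDefined t k a b ↔ ∀ i ∈ simples a b, ∀ m < k, t'.T^[m] i ∈ t.S₁ := by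
  refine forall₂_congr fun i _ => ⟨fun hk m hm => ?_, fun hk m hm => ?_⟩
  · rw [← h.iterate_eq m (.inl fun j hj => hk j (hj.trans hm))]
    exact hk m hm
  · rw [h.iterate_eq m (.inr fun j hj => hk j (hj.trans hm))]
    exact hk m hm

lemma AdmissibleTriple.Prec.powDefined {t t' : AdmissibleTriple ℓ} (h : t.Prec t') {k : ℕ}
    {a b : Fin (ℓ + 1)} (hk : PowDefined t k a b) : PowDefined t' k a b := fun i hi m hm =>
  h.1 ((h.powDefined_iff k a b).1 hk i hi m hm)

lemma AdmissibleTriple.Prec.rootImage_eq {t t' : AdmissibleTriple ℓ} (h : t.Prec t') {k : ℕ}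
    {a b : Fin (ℓ + 1)} (hk : PowDefined t k a b) :
    rootImage K t k a b = rootImage K t' k a b := by
  unfold rootImage
  congr 1
  refine List.map_congr_left fun i hi => ?_
  rw [h.iterate_eq k (.inl (hk i hi))]

/-- The total exit count of the simple roots `T'^k(i)`, `i` running over the positive root of
`e_{ab}`. -/
noncomputable def rootCount (t t' : AdmissibleTriple ℓ) (k : ℕ) (a b : Fin (ℓ + 1)) : ℕ :=
  ((simples a b).map fun i => exitCount t t' (t'.T^[k] i)).sum

lemma rootCount_le {t t' : AdmissibleTriple ℓ} {k : ℕ} {a b : Fin (ℓ + 1)}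
    (h : PowDefined t' k a b) : rootCount t t' k a b ≤ rootCount t t' 0 a b :=
  List.sum_le_sum fun i hi => exitCount_iterate_le k (h i hi)

lemma list_sum_map_eq_iff_of_le {ι : Type*} (l : List ι) (f g : ι → ℕ) (h : ∀ i ∈ l, f i ≤ g i) :
    (l.map f).sum = (l.map g).sum ↔ ∀ i ∈ l, f i = g i := by
  induction l with
  | nil => simp
  | cons i l ih =>
    have h1 := h i (by simp)
    have h2 := List.sum_le_sum fun j hj => h j (List.mem_cons_of_mem i hj)
    simp only [List.map_cons, List.sum_cons, List.forall_mem_cons,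
      ← ih fun j hj => h j (List.mem_cons_of_mem i hj)]
    lia

lemma AdmissibleTriple.Prec.rootCount_eq_iff {t t' : AdmissibleTriple ℓ} (h : t.Prec t') {k : ℕ}
    {a b : Fin (ℓ + 1)} (hk : PowDefined t' k a b) :
    rootCount t t' k a b = rootCount t t' 0 a b ↔ PowDefined t k a b := by
  rw [h.powDefined_iff, rootCount, rootCount,
    list_sum_map_eq_iff_of_le _ (fun i => exitCount t t' (t'.T^[k] i))
      (fun i => exitCount t t' (t'.T^[0] i)) fun i hi => exitCount_iterate_le k (hk i hi)]
  exact forall₂_congr fun i hi => exitCount_iterate_eq_iff k (hk i hi)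

/-! ### The one-parameter subgroup -/

/-- The total exit count of the simple roots `j ≥ a`. -/
noncomputable def tailCount (t t' : AdmissibleTriple ℓ) (a : Fin (ℓ + 1)) : ℤ :=
  ∑ j : Fin ℓ with a ≤ j.castSucc, (exitCount t t' j : ℤ)

/-- Integers `d_a` of sum zero such that `d_i - d_{i+1}` is `ℓ + 1` times the exit count of `i`. -/
noncomputable def coweight (t t' : AdmissibleTriple ℓ) (a : Fin (ℓ + 1)) : ℤ :=
  (ℓ + 1) * tailCount t t' a - ∑ c, tailCount t t' c

lemma sum_coweight (t t' : AdmissibleTriple ℓ) : ∑ a, coweight t t' a = 0 := by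
  simp [coweight, Finset.sum_sub_distrib, ← Finset.mul_sum]

lemma tailCount_sub (t t' : AdmissibleTriple ℓ) {a b : Fin (ℓ + 1)} (hab : a ≤ b) :
    tailCount t t' a - tailCount t t' b = rootCount t t' 0 a b := by
  have h1 : (rootCount t t' 0 a b : ℤ) =
      ∑ j : Fin ℓ with a ≤ j.castSucc ∧ j.castSucc < b, (exitCount t t' j : ℤ) := by
    have hnd : (simples a b).Nodup := (List.nodup_finRange ℓ).filter _
    have hfin : (Finset.univ.filter fun j : Fin ℓ => a ≤ j.castSucc ∧ j.castSucc < b) =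
        (simples a b).toFinset := by
      ext j; simp [simples]
    rw [hfin, ← Nat.cast_sum, List.sum_toFinset _ hnd]
    rfl
  rw [h1, sub_eq_iff_eq_add, tailCount, tailCount, ← Finset.sum_union]
  · refine Finset.sum_congr ?_ fun _ _ => rfl
    ext j
    simp only [Finset.mem_filter, Finset.mem_univ, true_and, Finset.mem_union]
    refine ⟨fun h => ?_, fun h => ?_⟩
    · exact (lt_or_ge j.castSucc b).imp (⟨h, ·⟩) id
    · exact h.elim (·.1) hab.trans
  · rw [Finset.disjoint_filter]
    exact fun j _ h1 h2 => absurd h1.2 (not_lt.2 h2)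

lemma coweight_sub (t t' : AdmissibleTriple ℓ) {a b : Fin (ℓ + 1)} (hab : a ≤ b) :
    coweight t t' a - coweight t t' b = (ℓ + 1) * rootCount t t' 0 a b := by
  rw [← tailCount_sub t t' hab, coweight, coweight]
  ring

lemma coweight_simple (t t' : AdmissibleTriple ℓ) (i : Fin ℓ) :
    coweight t t' i.castSucc - coweight t t' i.succ = (ℓ + 1) * exitCount t t' i := by
  have h : tailCount t t' i.castSucc = exitCount t t' i + tailCount t t' i.succ := by
    rw [tailCount, tailCount, ← Finset.sum_insert
      (s := Finset.univ.filter fun j : Fin ℓ => i.succ ≤ j.castSucc)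
      (f := fun j => (exitCount t t' j : ℤ)) (by simp)]
    refine Finset.sum_congr ?_ fun _ _ => rfl
    ext j
    simp only [Finset.mem_filter, Finset.mem_univ, true_and, Finset.mem_insert,
      Fin.castSucc_le_castSucc_iff, Fin.succ_le_castSucc_iff]
    rw [le_iff_eq_or_lt, eq_comm]
  rw [coweight, coweight, h]
  ring

/-- The diagonal matrix with entries `u ^ d_a`. -/
def torus {n : ℕ} (d : Fin n → ℤ) (u : K) : Mat n K := Matrix.diagonal fun a => u ^ d a

section Torus

variable {n : ℕ} {d : Fin n → ℤ} {u : K}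

lemma det_torus (hd : ∑ a, d a = 0) (hu : u ≠ 0) : (torus d u).det = 1 := by
  have h (s : Finset (Fin n)) : ∏ a ∈ s, u ^ d a = u ^ ∑ a ∈ s, d a := by
    classical
    induction s using Finset.induction_on with
    | empty => simp
    | insert a s ha ih => rw [Finset.prod_insert ha, Finset.sum_insert ha, ih, zpow_add₀ hu]
  rw [torus, Matrix.det_diagonal, h, hd, zpow_zero]

lemma torus_mul_inv (hu : u ≠ 0) : torus d u * (torus d u)⁻¹ = 1 := by
  refine Matrix.mul_nonsing_inv _ ?_
  rw [torus, Matrix.det_diagonal, isUnit_iff_ne_zero]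
  exact Finset.prod_ne_zero_iff.2 fun a _ => zpow_ne_zero _ hu

lemma conj_torus_of_isDiag (hu : u ≠ 0) {x : Mat n K} (hx : x.IsDiag) :
    torus d u * x * (torus d u)⁻¹ = x := by
  have hcomm : torus d u * x = x * torus d u := by
    rw [← hx.diagonal_diag, torus, Matrix.diagonal_mul_diagonal, Matrix.diagonal_mul_diagonal]
    simp only [mul_comm]
  rw [hcomm, mul_assoc, torus_mul_inv hu, mul_one]

lemma conj_torus_single (hu : u ≠ 0) (i j : Fin n) :
    torus d u * Matrix.single i j (1 : K) * (torus d u)⁻¹ =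
      u ^ (d i - d j) • Matrix.single i j (1 : K) := by
  have h : torus d u * Matrix.single i j (1 : K) =
      u ^ (d i - d j) • Matrix.single i j (1 : K) * torus d u := by
    ext a b
    simp only [torus, Matrix.diagonal_mul, Matrix.mul_diagonal, Matrix.smul_apply, smul_eq_mul,
      Matrix.single_apply]
    split_ifs with hab
    · rw [← hab.1, ← hab.2, zpow_sub₀ hu]
      field_simp [zpow_ne_zero (d j) hu]
    · simp
  rw [h, mul_assoc, torus_mul_inv hu, mul_one]

/-- An iterated bracket of weight vectors is a weight vector. The empty bracket causes no trouble,
being zero. -/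
lemma conj_torus_nestedBracket (hu : u ≠ 0) {ι : Type*} (x : ι → Mat n K) (w : ι → ℤ)
    (h : ∀ i, torus d u * x i * (torus d u)⁻¹ = u ^ w i • x i) (l : List ι) :
    torus d u * nestedBracket (l.map x) * (torus d u)⁻¹ =
      u ^ (l.map w).sum • nestedBracket (l.map x) := by
  have hinv : (torus d u)⁻¹ * torus d u = 1 := mul_eq_one_comm.1 (torus_mul_inv hu)
  have hmul (y z : Mat n K) : torus d u * (y * z) * (torus d u)⁻¹ =
      torus d u * y * (torus d u)⁻¹ * (torus d u * z * (torus d u)⁻¹) := by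
    calc torus d u * (y * z) * (torus d u)⁻¹
        = torus d u * y * 1 * z * (torus d u)⁻¹ := by simp only [mul_assoc, one_mul]
      _ = _ := by rw [← hinv]; simp only [mul_assoc]
  induction l with
  | nil => simp [nestedBracket]
  | cons i l ih =>
    cases l with
    | nil => simp [nestedBracket, h]
    | cons j l =>
      simp only [List.map_cons, nestedBracket, List.sum_cons] at ih ⊢
      rw [Ring.lie_def, mul_sub, sub_mul, hmul, hmul, ih, h, zpow_add₀ hu (w i)]
      simp only [smul_mul_smul_comm, smul_sub, mul_comm (u ^ w i)]

lemma conj2_wedge (g x y : Mat n K) :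
    conj2 g (wedge x y) = wedge (g * x * g⁻¹) (g * y * g⁻¹) := by
  simp [conj2, wedge]

lemma wedge_smul_smul (p q : K) (x y : Mat n K) : wedge (p • x) (q • y) = (p * q) • wedge x y := by
  simp only [wedge, TensorProduct.smul_tmul_smul, smul_sub, mul_comm q p]

lemma conj2_torus_gamma (hu : u ≠ 0) : conj2 (torus d u) (gamma n K) = gamma n K := by
  rw [gamma, map_sum]
  refine Finset.sum_congr rfl fun p _ => ?_
  rw [conj2_wedge, conj_torus_single hu, conj_torus_single hu, wedge_smul_smul, ← zpow_add₀ hu]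
  simp

lemma conj2_torus_wedgeSq_cartan (hu : u ≠ 0) {β : Mat n K ⊗[K] Mat n K}
    (hβ : β ∈ wedgeSq (cartan n K)) : conj2 (torus d u) β = β := by
  induction hβ using Submodule.span_induction with
  | mem w hw =>
    obtain ⟨x, hx, y, hy, rfl⟩ := hw
    rw [conj2_wedge, conj_torus_of_isDiag hu hx.2, conj_torus_of_isDiag hu hy.2]
  | zero => simp
  | add x y _ _ hx hy => rw [map_add, hx, hy]
  | smul c x _ hx => rw [map_smul, hx]

lemma conj2_torus_mem_orbit (hd : ∑ a, d a = 0) (hu : u ≠ 0) (r : Mat n K ⊗[K] Mat n K) :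
    conj2 (torus d u) r ∈ orbit r :=
  ⟨⟨torus d u, det_torus hd hu⟩, rfl⟩

end Torus

lemma conj_torus_rootImage (t t' : AdmissibleTriple ℓ) {u : K} (hu : u ≠ 0) (k : ℕ)
    (a b : Fin (ℓ + 1)) :
    torus (coweight t t') u * rootImage K t' k a b * (torus (coweight t t') u)⁻¹ =
      u ^ ((ℓ + 1) * rootCount t t' k a b : ℤ) • rootImage K t' k a b := by
  rw [rootImage, conj_torus_nestedBracket hu (fun i => simpleVec K (t'.T^[k] i))
    (fun i => (ℓ + 1) * exitCount t t' (t'.T^[k] i))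
    fun i => by rw [simpleVec, conj_torus_single hu, coweight_simple]]
  congr 2
  rw [List.sum_map_mul_left, rootCount, Nat.cast_list_sum, List.map_map]
  rfl

/-! ### The degeneration curve -/

open Classical in
/-- The polynomial curve `v ↦ F(v)` that for `v ≠ 0` is the conjugate of `γ + β + α(T')` by the
diagonal matrix with entries `v ^ (-d_a)`. The natural number subtraction in the exponent does not
truncate, by `rootCount_le`. -/
noncomputable def degeneration (β : Mat (ℓ + 1) K ⊗[K] Mat (ℓ + 1) K) (t t' : AdmissibleTriple ℓ)
    (v : K) : Mat (ℓ + 1) K ⊗[K] Mat (ℓ + 1) K :=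
  gamma (ℓ + 1) K + β + (2 : K) • ∑ k ∈ Finset.Icc 1 ℓ,
    ∑ p : Fin (ℓ + 1) × Fin (ℓ + 1) with p.1 < p.2 ∧ PowDefined t' k p.1 p.2,
      v ^ ((ℓ + 1) * (rootCount t t' 0 p.1 p.2 - rootCount t t' k p.1 p.2)) •
        wedge (rootImage K t' k p.1 p.2) (Matrix.single p.2 p.1 (1 : K))

lemma conj2_torus_bdTensor (t t' : AdmissibleTriple ℓ) {β : Mat (ℓ + 1) K ⊗[K] Mat (ℓ + 1) K}
    (hβ : β ∈ wedgeSq (cartan (ℓ + 1) K)) {v : K} (hv : v ≠ 0) :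
    conj2 (torus (coweight t t') v⁻¹) (bdTensor β t') = degeneration β t t' v := by
  have hu : v⁻¹ ≠ 0 := inv_ne_zero hv
  rw [bdTensor, degeneration, map_add, map_add, conj2_torus_gamma hu,
    conj2_torus_wedgeSq_cartan hu hβ, alpha, map_smul, map_sum]
  congr 2
  refine Finset.sum_congr rfl fun k _ => ?_
  rw [map_sum]
  refine Finset.sum_congr rfl fun p hp => ?_
  simp only [Finset.mem_filter, Finset.mem_univ, true_and] at hp
  rw [conj2_wedge, conj_torus_rootImage t t' hu, conj_torus_single hu, wedge_smul_smul,
    ← zpow_add₀ hu, inv_zpow', ← zpow_natCast]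
  congr 2
  have h1 := coweight_sub t t' hp.1.le
  rw [Nat.cast_mul, Nat.cast_sub (rootCount_le hp.2)]
  push_cast
  linear_combination h1

lemma degeneration_zero {t t' : AdmissibleTriple ℓ} (h : t.Prec t')
    (β : Mat (ℓ + 1) K ⊗[K] Mat (ℓ + 1) K) : degeneration β t t' 0 = bdTensor β t := by
  classical
  rw [bdTensor, degeneration, alpha]
  congr 2
  refine Finset.sum_congr rfl fun k _ => ?_
  rw [Finset.sum_filter, Finset.sum_filter]
  refine Finset.sum_congr rfl fun p _ => ?_
  by_cases hlt : p.1 < p.2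
  swap
  · simp [hlt]
  by_cases hk' : PowDefined t' k p.1 p.2
  swap
  · simp [hk', show ¬PowDefined t k p.1 p.2 from fun hk => hk' (h.powDefined hk)]
  have hle := rootCount_le (t := t) hk'
  by_cases hk : PowDefined t k p.1 p.2
  · simp [hlt, hk', hk, (h.rootCount_eq_iff hk').2 hk, h.rootImage_eq (K := K) hk]
  · have hne := mt (h.rootCount_eq_iff hk').1 hk
    rw [zero_pow (Nat.mul_ne_zero (by lia) (by lia))]
    simp [hk]

lemma exists_polynomial_dual_degeneration (β : Mat (ℓ + 1) K ⊗[K] Mat (ℓ + 1) K)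
    (t t' : AdmissibleTriple ℓ) (φ : Module.Dual K (Mat (ℓ + 1) K ⊗[K] Mat (ℓ + 1) K)) :
    ∃ P : Polynomial K, ∀ v, P.eval v = φ (degeneration β t t' v) := by
  classical
  refine ⟨.C (φ (gamma (ℓ + 1) K + β)) + .C 2 * ∑ k ∈ Finset.Icc 1 ℓ,
    ∑ p : Fin (ℓ + 1) × Fin (ℓ + 1) with p.1 < p.2 ∧ PowDefined t' k p.1 p.2,
      .X ^ ((ℓ + 1) * (rootCount t t' 0 p.1 p.2 - rootCount t t' k p.1 p.2)) *
        .C (φ (wedge (rootImage K t' k p.1 p.2) (Matrix.single p.2 p.1 (1 : K)))), fun v => ?_⟩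
  simp only [degeneration, map_add, map_smul, map_sum, Polynomial.eval_add, Polynomial.eval_mul,
    Polynomial.eval_C, Polynomial.eval_finsetSum, Polynomial.eval_pow, Polynomial.eval_X,
    smul_eq_mul]

/-! ### Closures -/

/-- A polynomial curve that lies in `S` away from the parameter `0` ends in the Zariski closure
of `S`. -/
lemma mem_zariskiClosure_of_curve [Infinite K] {V : Type*} [AddCommGroup V] [Module K V]
    {S : Set V} (F : K → V)
    (hF : ∀ φ : Module.Dual K V, ∃ P : Polynomial K, ∀ v, P.eval v = φ (F v))
    (hS : ∀ v ≠ 0, F v ∈ S) : F 0 ∈ zariskiClosure K S := by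
  intro f hf hfS
  have hP : ∃ P : Polynomial K, ∀ v, P.eval v = f (F v) := by
    clear hfS
    induction hf using Algebra.adjoin_induction with
    | mem f hf =>
      obtain ⟨φ, rfl⟩ := hf
      exact hF φ
    | algebraMap c => exact ⟨.C c, by simp⟩
    | add f g _ _ hf hg =>
      obtain ⟨P, hP⟩ := hf
      obtain ⟨Q, hQ⟩ := hg
      exact ⟨P + Q, by simp [hP, hQ]⟩
    | mul f g _ _ hf hg =>
      obtain ⟨P, hP⟩ := hf
      obtain ⟨Q, hQ⟩ := hg
      exact ⟨P * Q, by simp [hP, hQ]⟩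
  obtain ⟨P, hP⟩ := hP
  have hP0 : P = 0 := by
    refine Polynomial.eq_zero_of_infinite_isRoot P
      ((Set.finite_singleton (0 : K)).infinite_compl.mono fun v hv => ?_)
    exact (hP v).trans (hfS _ (hS v hv))
  rw [← hP, hP0, Polynomial.eval_zero]

lemma continuous_degeneration {𝕜 : Type*} [RCLike 𝕜]
    [TopologicalSpace (Mat (ℓ + 1) 𝕜 ⊗[𝕜] Mat (ℓ + 1) 𝕜)]
    [ContinuousAdd (Mat (ℓ + 1) 𝕜 ⊗[𝕜] Mat (ℓ + 1) 𝕜)]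
    [ContinuousSMul 𝕜 (Mat (ℓ + 1) 𝕜 ⊗[𝕜] Mat (ℓ + 1) 𝕜)]
    (β : Mat (ℓ + 1) 𝕜 ⊗[𝕜] Mat (ℓ + 1) 𝕜) (t t' : AdmissibleTriple ℓ) :
    Continuous (degeneration β t t') := by
  unfold degeneration
  fun_prop

lemma exp_smul_diagonal_intCast {𝕜 : Type*} [RCLike 𝕜] {n : ℕ} (d : Fin n → ℤ) (s : ℝ) :
    NormedSpace.exp ((s : 𝕜) • (Matrix.diagonal fun a => (d a : 𝕜) : Mat n 𝕜)) =
      torus d (((Real.exp (-s) : ℝ) : 𝕜)⁻¹) := by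
  rw [← Matrix.diagonal_smul, Matrix.exp_diagonal, torus]
  congr 1
  ext a
  have h1 : ((Real.exp (-s) : ℝ) : 𝕜)⁻¹ = NormedSpace.exp (s : 𝕜) := by
    rw [← RCLike.ofReal_inv, ← Real.exp_neg, neg_neg, Real.exp_eq_exp_ℝ]
    exact NormedSpace.algebraMap_exp_comm (𝕂 := ℝ) (𝔸 := 𝕜) s
  rw [Pi.coe_exp, h1, ← NormedSpace.exp_zsmul]
  simp [mul_comm]

lemma diagonal_intCast_mem_cartan {n : ℕ} {d : Fin n → ℤ} (hd : ∑ a, d a = 0) :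
    (Matrix.diagonal fun a => (d a : K)) ∈ cartan n K := by
  refine ⟨?_, Matrix.isDiag_diagonal _⟩
  change Matrix.trace (Matrix.diagonal fun a => (d a : K)) = 0
  rw [Matrix.trace_diagonal, ← Int.cast_sum, hd, Int.cast_zero]

lemma tendsto_conj2_exp {𝕜 : Type*} [RCLike 𝕜] {t t' : AdmissibleTriple ℓ} (h : t.Prec t')
    {β : Mat (ℓ + 1) 𝕜 ⊗[𝕜] Mat (ℓ + 1) 𝕜} (hβ : β ∈ wedgeSq (cartan (ℓ + 1) 𝕜)) :
    Filter.Tendsto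
      (fun s : ℝ => conj2
        (NormedSpace.exp ((s : 𝕜) • Matrix.diagonal fun a => (coweight t t' a : 𝕜)))
        (bdTensor β t'))
      Filter.atTop (@nhds _ (moduleTopology 𝕜 _) (bdTensor β t)) := by
  let : TopologicalSpace (Mat (ℓ + 1) 𝕜 ⊗[𝕜] Mat (ℓ + 1) 𝕜) := moduleTopology 𝕜 _
  have : IsModuleTopology 𝕜 (Mat (ℓ + 1) 𝕜 ⊗[𝕜] Mat (ℓ + 1) 𝕜) := ⟨rfl⟩
  have := IsModuleTopology.toContinuousAdd 𝕜 (Mat (ℓ + 1) 𝕜 ⊗[𝕜] Mat (ℓ + 1) 𝕜)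
  have := IsModuleTopology.toContinuousSMul 𝕜 (Mat (ℓ + 1) 𝕜 ⊗[𝕜] Mat (ℓ + 1) 𝕜)
  have hexp : Filter.Tendsto (fun s : ℝ => ((Real.exp (-s) : ℝ) : 𝕜)) Filter.atTop (𝓝 0) := by
    rw [← RCLike.ofReal_zero]
    exact (RCLike.continuous_ofReal.tendsto 0).comp
      (Real.tendsto_exp_atBot.comp Filter.tendsto_neg_atTop_atBot)
  have hlim := ((continuous_degeneration β t t').tendsto 0).comp hexp
  rw [degeneration_zero h] at hlim
  refine hlim.congr fun s => ?_
  have hs : ((Real.exp (-s) : ℝ) : 𝕜) ≠ 0 := RCLike.ofReal_ne_zero.2 (Real.exp_ne_zero _)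
  rw [Function.comp_apply, exp_smul_diagonal_intCast, conj2_torus_bdTensor t t' hβ hs]

end BelavinDrinfeld

theorem mainTheorem5 (ℓ : ℕ) (t t' : BelavinDrinfeld.AdmissibleTriple ℓ) (htt' : t.Prec t') :
    (∀ (K : Type*) [Field K] [CharZero K],
      ∀ β ∈ BelavinDrinfeld.wedgeSq (BelavinDrinfeld.cartan (ℓ + 1) K),
        BelavinDrinfeld.IsMCYBESolution (BelavinDrinfeld.bdTensor β t') →
          BelavinDrinfeld.bdTensor β t ∈ BelavinDrinfeld.zariskiClosure K
            (BelavinDrinfeld.orbit (BelavinDrinfeld.bdTensor β t'))) ∧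
    (∀ (𝕜 : Type*) [RCLike 𝕜],
      (∀ β ∈ BelavinDrinfeld.wedgeSq (BelavinDrinfeld.cartan (ℓ + 1) 𝕜),
        BelavinDrinfeld.IsMCYBESolution (BelavinDrinfeld.bdTensor β t') →
          BelavinDrinfeld.bdTensor β t ∈ @closure _ (moduleTopology 𝕜 _)
            (BelavinDrinfeld.orbit (BelavinDrinfeld.bdTensor β t'))) ∧
      ∃ h ∈ BelavinDrinfeld.cartan (ℓ + 1) 𝕜,
        ∀ β ∈ BelavinDrinfeld.wedgeSq (BelavinDrinfeld.cartan (ℓ + 1) 𝕜),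
          BelavinDrinfeld.IsMCYBESolution (BelavinDrinfeld.bdTensor β t') →
            Filter.Tendsto
              (fun s : ℝ => BelavinDrinfeld.conj2 (NormedSpace.exp ((s : 𝕜) • h))
                (BelavinDrinfeld.bdTensor β t'))
              Filter.atTop
              (@nhds _ (moduleTopology 𝕜 _) (BelavinDrinfeld.bdTensor β t))) := by
  refine ⟨fun K _ _ β hβ _ => ?_, fun 𝕜 _ => ⟨fun β hβ _ => ?_, ?_⟩⟩
  · have : Infinite K := Infinite.of_injective ((↑) : ℕ → K) Nat.cast_injective
    rw [← BelavinDrinfeld.degeneration_zero htt' β]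
    refine BelavinDrinfeld.mem_zariskiClosure_of_curve _
      (BelavinDrinfeld.exists_polynomial_dual_degeneration β t t') fun v hv => ?_
    rw [← BelavinDrinfeld.conj2_torus_bdTensor t t' hβ hv]
    exact BelavinDrinfeld.conj2_torus_mem_orbit (BelavinDrinfeld.sum_coweight t t')
      (inv_ne_zero hv) _
  · let _ := moduleTopology 𝕜
      (TensorProduct 𝕜 (BelavinDrinfeld.Mat (ℓ + 1) 𝕜) (BelavinDrinfeld.Mat (ℓ + 1) 𝕜))
    refine mem_closure_of_tendsto (BelavinDrinfeld.tendsto_conj2_exp htt' hβ)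
      (Filter.Eventually.of_forall fun s => ?_)
    rw [BelavinDrinfeld.exp_smul_diagonal_intCast]
    exact BelavinDrinfeld.conj2_torus_mem_orbit (BelavinDrinfeld.sum_coweight t t')
      (inv_ne_zero (RCLike.ofReal_ne_zero.2 (Real.exp_ne_zero _))) _
  · exact ⟨_, BelavinDrinfeld.diagonal_intCast_mem_cartan (BelavinDrinfeld.sum_coweight t t'),
      fun β hβ _ => BelavinDrinfeld.tendsto_conj2_exp htt' hβ⟩
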